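/- A median algebra is a set $M$ with a map $m\colon M^3\to M$ that is invariant under permutations of its three arguments and satisfies $m(x,x,y)=x$ and $m(m(x,y,z),y,w)=m(x,y,m(z,y,w))$ for all $x,y,z,w\in M$. Its rank is the supremum of the $k\in\mathbb{N}$ such that $M$ contains a median subalgebra isomorphic to $\{0,1\}^k$ (with the coordinatewise majority operation). A subset $C\subseteq M$ is convex if $m(x,y,z)\in C$ for all $x,y\in C$ and $z\in M$; a convex subset is itself a median algebra. A halfspace of $M$ is a nonempty convex subset $\mathfrak{h}\subseteq M$ whose complement $\mathfrak{h}^*=M\setminus\mathfrak{h}$ is also nonempty and convex. An action $G\curvearrowright M$ by median automorphisms is: essential if for every halfspace $\mathfrak{h}$ of $M$ there exists $g\in G$ with $g\mathfrak{h}\subsetneq\mathfrak{h}$; minimal if the only nonempty, $G$-invariant, convex subset of $M$ is $M$ itself; without wall inversions if there are no halfspace $\mathfrak{h}$ of $M$ and $g\in G$ with $g\mathfrak{h}=\mathfrak{h}^*$. Theorem. Let $M$ be a nonempty median algebra of finite rank. Let $G$ be a finitely generated group acting on $M$ by median automorphisms without wall inversions. Then: (1) there exists a nonempty, $G$-invariant,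 convex subset $C\subseteq M$ such that the restricted action $G\curvearrowright C$ on the median algebra $C$ is essential; (2) $G\curvearrowright M$ is essential if and only if $G\curvearrowright M$ is minimal. -/

import Mathlib

open scoped Pointwise

/-- A median algebra: a set with a symmetric ternary operation `m` satisfying the majority law
`m x x y = x` and `m (m x y z) y w = m x y (m z y w)`. -/
class MedianAlgebra (M : Type*) where
  /-- the median operation -/
  m : M → M → M → M
  m_self : ∀ x y, m x x y = x
  /-- Invariance under the two transpositions that generate `Sym(3)`. -/
  m_swap_left : ∀ x y z, m x y z = m y x z
  m_swap_right : ∀ x y z, m x y z = m x z y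
  m_assoc : ∀ x y z w, m (m x y z) y w = m x y (m z y w)

namespace MedianAlgebra

/-- The two-point median algebra `{0,1}` (majority vote). -/
instance : MedianAlgebra Bool where
  m x y z := (x && y) || (y && z) || (z && x)
  m_self := by decide
  m_swap_left := by decide
  m_swap_right := by decide
  m_assoc := by decide

/-- Products of median algebras, with the coordinatewise median. In particular
`Fin k → Bool` is the vertex set `{0,1}^k` of a `k`-cube. -/
instance {ι : Type*} {M : ι → Type*} [∀ i, MedianAlgebra (M i)] : MedianAlgebra (∀ i, M i) where
  m x y z i := m (x i) (y i) (z i)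
  m_self _ _ := funext fun _ => m_self _ _
  m_swap_left _ _ _ := funext fun _ => m_swap_left _ _ _
  m_swap_right _ _ _ := funext fun _ => m_swap_right _ _ _
  m_assoc _ _ _ _ := funext fun _ => m_assoc _ _ _ _

/-- A median morphism. -/
def IsMorphism {M N : Type*} [MedianAlgebra M] [MedianAlgebra N] (f : M → N) : Prop :=
  ∀ x y z, f (m x y z) = m (f x) (f y) (f z)

/-- `M` contains a median subalgebra isomorphic to `{0,1}^k`, namely the image of an injective
median morphism from `{0,1}^k` to `M`. -/
def ContainsCube (M : Type*) [MedianAlgebra M] (k : ℕ) : Prop :=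
  ∃ f : (Fin k → Bool) → M, Function.Injective f ∧ IsMorphism f

/-- The rank of `M`: the supremum of the `k` such that `M` contains a `k`-cube. -/
noncomputable def rank (M : Type*) [MedianAlgebra M] : ℕ∞ :=
  ⨆ (k : ℕ) (_ : ContainsCube M k), (k : ℕ∞)

/-- Convex subsets of a median algebra. -/
def IsConvex {M : Type*} [MedianAlgebra M] (C : Set M) : Prop :=
  ∀ x ∈ C, ∀ y ∈ C, ∀ z, m x y z ∈ C

/-- Halfspaces: nonempty convex subsets whose complement is also nonempty and convex. -/
def IsHalfspace {M : Type*} [MedianAlgebra M] (h : Set M) : Prop :=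
  h.Nonempty ∧ IsConvex h ∧ hᶜ.Nonempty ∧ IsConvex hᶜ

/-- The group action `G ↷ M` is by median automorphisms. -/
class IsMedianAction (G M : Type*) [Group G] [MedianAlgebra M] [MulAction G M] : Prop where
  smul_m : ∀ (g : G) (x y z : M), g • m x y z = m (g • x) (g • y) (g • z)

section Action

variable (G M : Type*) [Group G] [MedianAlgebra M] [MulAction G M]

/-- Essential: every halfspace `h` satisfies `g h ⊊ h` for some `g`. -/
def IsEssential : Prop :=
  ∀ h : Set M, IsHalfspace h → ∃ g : G, g • h ⊂ h

/-- Minimal: there is no nonempty, `G`-invariant, convex subset other than `M` itself. -/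
def IsMinimal : Prop :=
  ∀ C : Set M, C.Nonempty → (∀ g : G, g • C = C) → IsConvex C → C = Set.univ

/-- Without wall inversions: no element of `G` maps a halfspace to its complement. -/
def WithoutWallInversions : Prop :=
  ∀ h : Set M, IsHalfspace h → ∀ g : G, g • h ≠ hᶜ

/-- `G`-invariant convex subsets of `M` (possibly empty). -/
structure InvariantConvexSubset extends SubMulAction G M where
  isConvex' : IsConvex carrier

end Action

namespace InvariantConvexSubset

variable {G M : Type*} [Group G] [MedianAlgebra M] [MulAction G M]

instance : SetLike (InvariantConvexSubset G M) M where
  coe C := C.carrier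
  coe_injective C D h := by
    obtain ⟨⟨_, _⟩, _⟩ := C
    obtain ⟨⟨_, _⟩, _⟩ := D
    cases h
    rfl

/-- The induced median algebra structure on an invariant convex subset. -/
instance (C : InvariantConvexSubset G M) : MedianAlgebra C where
  m x y z := ⟨m (x : M) y z, C.isConvex' x x.2 y y.2 z⟩
  m_self _ _ := Subtype.ext (m_self _ _)
  m_swap_left _ _ _ := Subtype.ext (m_swap_left _ _ _)
  m_swap_right _ _ _ := Subtype.ext (m_swap_right _ _ _)
  m_assoc _ _ _ _ := Subtype.ext (m_assoc _ _ _ _)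

/-- The restricted action on an invariant convex subset. -/
instance (C : InvariantConvexSubset G M) : MulAction G C where
  smul g x := ⟨g • (x : M), C.smul_mem' g x.2⟩
  one_smul _ := Subtype.ext (one_smul _ _)
  mul_smul _ _ _ := Subtype.ext (mul_smul _ _ _)

/-- The restricted action is again by median automorphisms. -/
instance (C : InvariantConvexSubset G M) [IsMedianAction G M] : IsMedianAction G C where
  smul_m g _ _ _ := Subtype.ext (IsMedianAction.smul_m g _ _ _)

end InvariantConvexSubset

end MedianAlgebra

/-!
Call a halfspace `h` *nonskewered* if no group element maps it strictly into itself. The essential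
core is the convex hull of the orbit of a point `y` such that no nonskewered halfspace separates two
points of `G y`: every halfspace of the hull is the trace of a halfspace of `M` crossing `G y`, and
such a halfspace is mapped strictly into itself by some `g` (`isEssential_orbitHull`). So the
problem is to find `y` (`exists_crossing_eq_empty`).

Four facts carry the construction. Finite rank enters through a bound `r` on the number of pairwise
transverse halfspaces (`containsCube_of_transverse`).

* Chains of nonskewered halfspaces separating two given points have nonskewered intersections
  (`isNonskewered_sInter`): otherwise, far down the chain, some member and its first `r` translates
  by powers of one element would be pairwise transverse. Hence the minimal members of suitable
  families of halfspaces separating two points exist; being pairwise transverse, they are finite in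
  number (`RankLE.exists_finset_containsOrbit`).
* One side of each nonskewered halfspace contains an orbit (`IsNonskewered.containsOrbit_or`).
  If the translates of `h` intersect pairwise, those missing a given point are pairwise transverse
  or equal, hence finite in number, and Helly's theorem applies. If some `g h` is disjoint from `h`,
  it is not the complement, since there are no wall inversions, so the translates of the complement
  intersect pairwise.
* There is a finite `F ⊆ G` such that an orbit `G z` that meets a nonskewered `h` with pairwise
  intersecting translates does so already in `F z` (`exists_detectsOrbits`). The translates of `h`
  by the elements of a ball of `G` that miss `z` number at most `r`, so if all of them miss `z`,
  a ball of radius `r` already exhausts the `G`-orbit of `h`. This is where finite generation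
  is used.
* If `y` is the gate of `x` in the hull of `z` and `F z`, the nonskewered halfspaces crossing `G y`
  cross both `G x` and `G z` (`DetectsOrbits.exists_crossing_subset`).

A halfspace crossing `G x` has a translate that separates `x` from `s x`, where `s` or its inverse
is one of the finitely many generators. Thus, if the minimal members of the relevant families contain
orbits, replacing `x` by gates towards these finitely many orbits removes all members of the families
at once (`DetectsOrbits.exists_crossing_disjoint`). This is done twice: first for the halfspaces
whose complement contains no orbit, and then for all remaining ones, both sides of which contain
orbits.

An essential action is minimal by Zorn's lemma (`IsEssential.isMinimal`); conversely, the core of a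
minimal action is everything.
-/

namespace MedianAlgebra

/-! ### Betweenness -/

section Betweenness

variable {M : Type*} [MedianAlgebra M]

/-- `Btw x z y`: the point `z` lies in the interval between `x` and `y`. For fixed `x` this is the
order relation `z ≤ y` of the semilattice with meet `m x` and least element `x`. -/
def Btw (x z y : M) : Prop := m x z y = z

theorem m_rotate (x y z : M) : m x y z = m y z x := by
  rw [m_swap_left, m_swap_right]

theorem m_inf_assoc (x a b c : M) : m x (m x a b) c = m x a (m x b c) := by
  have h := m_assoc a x b c
  rw [m_swap_left a x b, m_swap_left b x c, m_swap_left a x, m_swap_left _ x c] at h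
  exact h

theorem m_inf_self (x a : M) : m x a a = a := by
  rw [m_rotate, m_self]

theorem btw_comm {x z y : M} : Btw x z y ↔ Btw y z x := by
  unfold Btw
  rw [m_rotate x z y, m_rotate z y x, m_swap_right y x z]

theorem Btw.symm {x z y : M} (h : Btw x z y) : Btw y z x := btw_comm.1 h

theorem Btw.trans {x a b c : M} (h : Btw x a b) (h' : Btw x b c) : Btw x a c := by
  unfold Btw at *
  rw [← h, m_inf_assoc, h']

theorem Btw.antisymm {x a b : M} (h : Btw x a b) (h' : Btw x b a) : a = b := by
  unfold Btw at *
  rw [← h, m_swap_right, h']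

theorem btw_m (x y z : M) : Btw x (m x y z) y := by
  unfold Btw
  rw [m_swap_right x (m x y z) y, ← m_inf_assoc, m_inf_self]

theorem btw_m' (x y z : M) : Btw x (m x y z) z := by
  rw [m_swap_right]
  exact btw_m x z y

theorem btw_m'' (x y z : M) : Btw y (m x y z) z := by
  rw [m_rotate]
  exact btw_m y z x

theorem Btw.inf {x p y z : M} (h : Btw x p y) (h' : Btw x p z) : Btw x p (m x y z) := by
  unfold Btw at *
  rw [← m_inf_assoc, h, h']

theorem Btw.eq_left {x y : M} (h : Btw x y x) : y = x := by
  unfold Btw at h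
  rw [← h, m_swap_right, m_self]

theorem Btw.inner {a y x b : M} (h : Btw a y x) (h' : Btw a x b) : Btw y x b := by
  have h1 : Btw x (m x y b) a := (btw_m x y b).trans h.symm
  have h2 : Btw x (m x y b) b := btw_m' x y b
  have h3 : m x a b = x := by rw [m_swap_left]; exact h'
  have h4 := h1.inf h2
  rw [h3] at h4
  have h5 := h4.eq_left
  unfold Btw
  rw [m_swap_left, h5]

/-- The median is the only point lying between each two of the three given points. -/
theorem eq_m_of_btw {x y z p : M} (hxy : Btw x p y) (hyz : Btw y p z) (hxz : Btw x p z) :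
    p = m x y z := by
  have h1 : Btw x p (m x y z) := hxy.inf hxz
  have h2 : Btw y p (m x y z) := by
    rw [m_swap_left]
    exact hxy.symm.inf hyz
  have h3 := h1.symm.inf h2.symm
  have h4 : m (m x y z) x y = m x y z := by
    rw [m_swap_left]
    exact btw_m x y z
  rw [h4] at h3
  exact h3.eq_left

/-- The point `m t u v` is the gate of `t` in the interval between `u` and `v`. -/
theorem btw_gate {u a v : M} (t : M) (ha : Btw u a v) : Btw t (m t u v) a := by
  set c := m t u v with hc
  set q := m t c a with hq
  have hqc : Btw t q c := btw_m t c a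
  have hcu : Btw q c u := hqc.inner (btw_m t u v)
  have hcv : Btw q c v := hqc.inner (btw_m' t u v)
  have hcuv : Btw u c v := btw_m'' t u v
  have hqca : Btw c q a := btw_m'' t c a
  -- `w` is the meet of `q` and `a` as seen from `u`; it precedes `c` since `a` precedes `v`.
  set w := m u q a with hw
  have hwq : Btw u w q := btw_m u q a
  have hwa : Btw u w a := btw_m' u q a
  have hwc : Btw u w c := by
    rw [eq_m_of_btw hcu.symm hcv hcuv]
    exact hwq.inf (hwa.trans ha)
  have h1 : Btw w c q := hwc.inner hcu.symm
  have h2 : Btw w q c := (btw_m'' u q a).symm.inner hqca.symm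
  rw [h1.antisymm h2]
  exact btw_m' t c a

theorem btw_interval {u a w v t : M} (ha : Btw u a v) (hw : Btw u w v) (ht : Btw a t w) :
    Btw u t v := by
  have h := (btw_gate t ha).inf (btw_gate t hw)
  have h1 : m t a w = t := by
    rw [m_rotate, m_swap_right]
    exact ht
  rw [h1] at h
  rw [← h.eq_left]
  exact btw_m'' t u v

/-! ### Convex sets and separation by halfspaces -/

theorem IsConvex.mem_of_btw {C : Set M} (hC : IsConvex C) {x z y : M} (hx : x ∈ C) (hy : y ∈ C)
    (h : Btw x z y) : z ∈ C := by
  rw [← show m x z y = z from h, m_swap_right]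
  exact hC x hx y hy z

theorem isConvex_of_btw {C : Set M} (h : ∀ x ∈ C, ∀ y ∈ C, ∀ z, Btw x z y → z ∈ C) :
    IsConvex C :=
  fun x hx y hy z => h x hx y hy _ (btw_m x y z)

theorem IsConvex.inter {C D : Set M} (hC : IsConvex C) (hD : IsConvex D) : IsConvex (C ∩ D) :=
  fun x hx y hy z => ⟨hC x hx.1 y hy.1 z, hD x hx.2 y hy.2 z⟩

theorem isConvex_sInter {S : Set (Set M)} (hS : ∀ C ∈ S, IsConvex C) : IsConvex (⋂₀ S) :=
  fun x hx y hy z C hC => hS C hC x (hx C hC) y (hy C hC) z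

theorem isConvex_sUnion_of_isChain {S : Set (Set M)} (hS : ∀ C ∈ S, IsConvex C)
    (hc : IsChain (· ⊆ ·) S) : IsConvex (⋃₀ S) := by
  rintro x ⟨C, hC, hx⟩ y ⟨D, hD, hy⟩ z
  rcases hc.total hC hD with h | h
  · exact ⟨D, hD, hS D hD x (h hx) y hy z⟩
  · exact ⟨C, hC, hS C hC x hx y (h hy) z⟩

theorem isConvex_compl_sInter_of_isChain {S : Set (Set M)} (hS : ∀ C ∈ S, IsConvex Cᶜ)
    (hc : IsChain (· ⊆ ·) S) : IsConvex (⋂₀ S)ᶜ := by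
  rw [Set.compl_sInter]
  apply isConvex_sUnion_of_isChain
  · rintro _ ⟨C, hC, rfl⟩
    exact hS C hC
  · rintro _ ⟨C, hC, rfl⟩ _ ⟨D, hD, rfl⟩ -
    rcases hc.total hC hD with hle | hle
    · exact Or.inr (Set.compl_subset_compl.2 hle)
    · exact Or.inl (Set.compl_subset_compl.2 hle)

/-- The union of the intervals joining a fixed point to the points of a convex set is convex. -/
theorem IsConvex.join {C : Set M} (hC : IsConvex C) (p : M) :
    IsConvex {z | ∃ c ∈ C, Btw p z c} := by
  apply isConvex_of_btw
  rintro s ⟨c, hc, hs⟩ t ⟨d, hd, ht⟩ q hq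
  refine ⟨m q c d, hC.mem_of_btw hc hd (btw_m'' q c d), ?_⟩
  -- Seen from `q`, the meet of `c`, `d` and `p` lies below both `s` and `t`.
  have h1 : Btw q (m q (m q c d) p) s :=
    ((btw_m q _ p).trans (btw_m q c d)).inf (btw_m' q _ p) |>.trans (btw_gate q hs.symm)
  have h2 : Btw q (m q (m q c d) p) t :=
    ((btw_m q _ p).trans (btw_m' q c d)).inf (btw_m' q _ p) |>.trans (btw_gate q ht.symm)
  have h3 := h1.inf h2
  have h4 : m q s t = q := by
    rw [m_swap_left]
    exact hq
  rw [h4] at h3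
  have h5 := btw_m'' q (m q c d) p
  rw [h3.eq_left] at h5
  exact h5.symm

/-- Pasch's axiom, for convex sets. -/
theorem IsConvex.pasch {A B : Set M} (hA : IsConvex A) (hB : IsConvex B) {p a a' b b' : M}
    (ha : a ∈ A) (ha' : a' ∈ A) (hb : b ∈ B) (hb' : b' ∈ B) (h : Btw p b a) (h' : Btw p a' b') :
    (A ∩ B).Nonempty := by
  set n := m p a a' with hn
  have hnA : n ∈ A := hA.mem_of_btw ha ha' (btw_m'' p a a')
  have hnpa : Btw p n a := btw_m p a a'
  have hnpb : Btw p n b' := (btw_m' p a a').trans h'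
  have hqn : Btw n (m n b b') b := btw_m n b b'
  have hqnb : Btw n (m n b b') b' := btw_m' n b b'
  have hq : Btw p (m n b b') a := btw_interval hnpa h hqn
  have hpnq : Btw p n (m n b b') := by
    have := hqnb.symm.inner hnpb.symm
    exact this.symm
  have hqa : Btw n (m n b b') a := hpnq.inner hq
  exact ⟨m n b b', hA.mem_of_btw hnA ha hqa, hB.mem_of_btw hb hb' (btw_m'' n b b')⟩

theorem exists_maximal_isConvex_disjoint {A B : Set M} (hA : IsConvex A) (hAB : Disjoint A B) :
    ∃ C, A ⊆ C ∧ Maximal (fun C => IsConvex C ∧ Disjoint C B) C := by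
  refine zorn_subset_nonempty {C | IsConvex C ∧ Disjoint C B} ?_ A ⟨hA, hAB⟩
  intro c hc hch _
  refine ⟨⋃₀ c, ⟨isConvex_sUnion_of_isChain (fun C hC => (hc hC).1) hch, ?_⟩,
    fun s hs => Set.subset_sUnion_of_mem hs⟩
  rw [Set.disjoint_sUnion_left]
  exact fun C hC => (hc hC).2

/-- Disjoint nonempty convex sets are separated by a halfspace. -/
theorem exists_isHalfspace_separating {A B : Set M} (hA : IsConvex A) (hB : IsConvex B)
    (hA' : A.Nonempty) (hB' : B.Nonempty) (hAB : Disjoint A B) :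
    ∃ h, IsHalfspace h ∧ A ⊆ h ∧ B ⊆ hᶜ := by
  obtain ⟨C, hAC, ⟨hC, hCB⟩, hCmax⟩ := exists_maximal_isConvex_disjoint hA hAB
  obtain ⟨D, hBD, ⟨hD, hDC⟩, hDmax⟩ := exists_maximal_isConvex_disjoint hB hCB.symm
  have hcompl : D = Cᶜ := by
    apply Set.Subset.antisymm hDC.subset_compl_right
    intro p hp
    by_contra hpD
    have key : ∀ {E : Set M}, IsConvex E → E.Nonempty →
        E ⊆ {z | ∃ c ∈ E, Btw p z c} ∧ p ∈ {z | ∃ c ∈ E, Btw p z c} := by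
      rintro E - ⟨e, he⟩
      exact ⟨fun z hz => ⟨z, hz, m_inf_self p z⟩, e, he, m_self p e⟩
    obtain ⟨b', hb', a, ha, hba⟩ : ∃ b ∈ D, ∃ a ∈ C, Btw p b a := by
      by_contra hcon
      have hdis : Disjoint {z | ∃ c ∈ C, Btw p z c} B := by
        rw [Set.disjoint_left]
        rintro z ⟨c, hc, hz⟩ hzB
        exact hcon ⟨z, hBD hzB, c, hc, hz⟩
      exact hp (hCmax ⟨hC.join p, hdis⟩ (key hC (hA'.mono hAC)).1 (key hC (hA'.mono hAC)).2)
    obtain ⟨a', ha', b, hb, hab⟩ : ∃ a ∈ C, ∃ b ∈ D, Btw p a b := by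
      by_contra hcon
      have hdis : Disjoint {z | ∃ c ∈ D, Btw p z c} C := by
        rw [Set.disjoint_left]
        rintro z ⟨c, hc, hz⟩ hzC
        exact hcon ⟨z, hzC, c, hc, hz⟩
      exact hpD (hDmax ⟨hD.join p, hdis⟩ (key hD (hB'.mono hBD)).1 (key hD (hB'.mono hBD)).2)
    obtain ⟨q, hqC, hqD⟩ := hC.pasch hD ha ha' hb' hb hba hab
    exact Set.disjoint_left.1 hDC hqD hqC
  subst hcompl
  exact ⟨C, ⟨hA'.mono hAC, hC, hB'.mono hBD, hD⟩, hAC, hBD⟩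

end Betweenness

/-! ### Halfspaces and Helly's theorem -/

/-- Two halfspaces are transverse if all four intersections of their sides are nonempty. -/
def Transverse {α : Type*} (h k : Set α) : Prop :=
  (h ∩ k).Nonempty ∧ (h ∩ kᶜ).Nonempty ∧ (hᶜ ∩ k).Nonempty ∧ (hᶜ ∩ kᶜ).Nonempty

theorem Transverse.symm {α : Type*} {h k : Set α} (hk : Transverse h k) : Transverse k h := by
  unfold Transverse at *
  rw [Set.inter_comm k h, Set.inter_comm k hᶜ, Set.inter_comm kᶜ h, Set.inter_comm kᶜ hᶜ]
  tauto

section Halfspaces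

variable {M : Type*} [MedianAlgebra M]

theorem IsHalfspace.compl {h : Set M} (hh : IsHalfspace h) : IsHalfspace hᶜ :=
  ⟨hh.2.2.1, hh.2.2.2, by rw [compl_compl]; exact hh.1, by rw [compl_compl]; exact hh.2.1⟩

/-- Membership of a median in a halfspace is decided by majority vote. -/
theorem IsHalfspace.m_mem_iff {h : Set M} (hh : IsHalfspace h) (x y z : M) :
    m x y z ∈ h ↔ (x ∈ h ∧ y ∈ h) ∨ (y ∈ h ∧ z ∈ h) ∨ (z ∈ h ∧ x ∈ h) := by
  have key : ∀ {C : Set M}, IsConvex C →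
      (x ∈ C ∧ y ∈ C) ∨ (y ∈ C ∧ z ∈ C) ∨ (z ∈ C ∧ x ∈ C) → m x y z ∈ C := by
    rintro C hC (⟨h1, h2⟩ | ⟨h1, h2⟩ | ⟨h1, h2⟩)
    · exact hC x h1 y h2 z
    · rw [m_rotate]; exact hC y h1 z h2 x
    · rw [m_rotate, m_rotate]; exact hC z h1 x h2 y
  refine ⟨fun hm => ?_, key hh.2.1⟩
  by_contra hcon
  refine key hh.2.2.2 ?_ hm
  simp only [Set.mem_compl_iff]
  tauto

theorem isConvex_singleton (x : M) : IsConvex {x} := by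
  rintro _ rfl _ rfl z
  exact m_self _ z

/-- Points are determined by the halfspaces containing them. -/
theorem eq_of_forall_isHalfspace {x y : M} (hxy : ∀ h, IsHalfspace h → (x ∈ h ↔ y ∈ h)) :
    x = y := by
  by_contra hne
  obtain ⟨h, hh, hx, hy⟩ := exists_isHalfspace_separating (isConvex_singleton x)
    (isConvex_singleton y) (Set.singleton_nonempty x) (Set.singleton_nonempty y)
    (Set.disjoint_singleton.2 hne)
  exact hy rfl ((hxy h hh).1 (hx rfl))

/-- Helly's theorem: pairwise intersecting convex sets, finite in number, have a common point. -/
theorem helly [Nonempty M] {ι : Type*} (T : Finset ι) (f : ι → Set M)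
    (hf : ∀ i ∈ T, IsConvex (f i)) (hT : ∀ i ∈ T, ∀ j ∈ T, (f i ∩ f j).Nonempty) :
    ∃ x, ∀ i ∈ T, x ∈ f i := by
  classical
  induction T using Finset.induction_on generalizing f with
  | empty => exact ⟨Classical.arbitrary M, by simp⟩
  | insert i T hi ih =>
    rcases T.eq_empty_or_nonempty with rfl | ⟨j₀, hj₀⟩
    · obtain ⟨x, hx, -⟩ := hT i (by simp) i (by simp)
      exact ⟨x, by simpa using hx⟩
    obtain ⟨x, hx⟩ := ih (fun j => f j ∩ f i)
      (fun j hj => (hf j (by simp [hj])).inter (hf i (by simp))) (by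
        intro j hj k hk
        obtain ⟨a, haj, hak⟩ := hT j (by simp [hj]) k (by simp [hk])
        obtain ⟨b, hbj, hbi⟩ := hT j (by simp [hj]) i (by simp)
        obtain ⟨c, hck, hci⟩ := hT k (by simp [hk]) i (by simp)
        have hi' := hf i (by simp)
        have h1 : m a b c ∈ f j := hf j (by simp [hj]) a haj b hbj c
        have h2 : m a b c ∈ f k := by
          rw [m_swap_right]; exact hf k (by simp [hk]) a hak c hck b
        have h3 : m a b c ∈ f i := by
          rw [m_rotate]; exact hi' b hbi c hci a
        exact ⟨_, ⟨h1, h3⟩, h2, h3⟩)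
    refine ⟨x, fun k hk => ?_⟩
    rcases Finset.mem_insert.1 hk with rfl | hk
    · exact (hx j₀ hj₀).2
    · exact (hx k hk).1

/-! ### Transverse halfspaces and rank -/

/-- The iterated median `m y a₁ (m y a₂ (⋯ x))` over the entries `aᵢ` of a list: the join of `x` and
the `aᵢ` in the order with greatest element `y`, which is the gate of `y` in their convex hull. -/
def joinList (x y : M) (l : List M) : M := l.foldr (m y) x

theorem IsHalfspace.joinList_mem_iff {h : Set M} (hh : IsHalfspace h) {x y : M} (hx : x ∉ h)
    (hy : y ∈ h) (l : List M) : joinList x y l ∈ h ↔ ∃ a ∈ l, a ∈ h := by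
  induction l with
  | nil => simpa [joinList] using hx
  | cons b l ih =>
    have : joinList x y (b :: l) = m y b (joinList x y l) := rfl
    rw [this, hh.m_mem_iff, ih]
    simp only [List.mem_cons, exists_eq_or_imp]
    tauto

theorem IsHalfspace.joinList_mem {h : Set M} (hh : IsHalfspace h) {x y : M} (hx : x ∈ h)
    (hy : y ∈ h) (l : List M) : joinList x y l ∈ h := by
  induction l with
  | nil => simpa [joinList] using hx
  | cons b l ih =>
    have : joinList x y (b :: l) = m y b (joinList x y l) := rfl
    rw [this, hh.m_mem_iff]
    tauto

/-- Pairwise transverse halfspaces give rise to a cube of the same dimension. -/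
theorem containsCube_of_transverse [Nonempty M] {k : ℕ} (h : Fin k → Set M)
    (hh : ∀ i, IsHalfspace (h i)) (ht : ∀ i j, i ≠ j → Transverse (h i) (h j)) :
    ContainsCube M k := by
  classical
  have hsec : ∀ ε : Fin k → Prop, ∃ p, ∀ i, p ∈ h i ↔ ε i := by
    intro ε
    obtain ⟨p, hp⟩ := helly Finset.univ (fun i => if ε i then h i else (h i)ᶜ) (by
      intro i _
      by_cases hi : ε i <;> simp only [hi, if_true, if_false]
      · exact (hh i).2.1
      · exact (hh i).2.2.2) (by
      intro i _ j _
      by_cases hij : i = j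
      · subst hij
        rw [Set.inter_self]
        by_cases hi : ε i <;> simp only [hi, if_true, if_false]
        · exact (hh i).1
        · exact (hh i).2.2.1
      · obtain ⟨h1, h2, h3, h4⟩ := ht i j hij
        by_cases hi : ε i <;> by_cases hj : ε j <;> simpa only [hi, hj, if_true, if_false])
    refine ⟨p, fun i => ?_⟩
    have := hp i (Finset.mem_univ i)
    by_cases hi : ε i
    · simpa [hi] using this
    · simpa [hi] using this
  obtain ⟨x, hx⟩ := hsec fun _ => False
  obtain ⟨y, hy⟩ := hsec fun _ => True
  choose a ha using fun i => hsec fun j => j = i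
  simp only [iff_false, iff_true] at hx hy
  -- `z` is the join of all meets `a i ∧ a j` with `i ≠ j`; the joins of `z` with the `a i` are
  -- pairwise disjoint above `z`, hence span a cube.
  let P : List M := ((Finset.univ : Finset (Fin k × Fin k)).filter
    (fun p => p.1 ≠ p.2)).toList.map fun p => m x (a p.1) (a p.2)
  let Q : (Fin k → Bool) → List M := fun ε =>
    ((Finset.univ : Finset (Fin k)).filter fun i => ε i = true).toList.map a
  have hP : ∀ H : Set M, (∃ b ∈ P, b ∈ H) ↔ ∃ i j, i ≠ j ∧ m x (a i) (a j) ∈ H := by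
    intro H
    simp [P]
  have hQ : ∀ ε (H : Set M), (∃ b ∈ Q ε, b ∈ H) ↔ ∃ i, ε i = true ∧ a i ∈ H := by
    intro ε H
    simp [Q]
  let φ : (Fin k → Bool) → M := fun ε => joinList x y (P ++ Q ε)
  have hφ : ∀ ε H, IsHalfspace H → x ∉ H → y ∈ H →
      (φ ε ∈ H ↔ (∃ i j, i ≠ j ∧ a i ∈ H ∧ a j ∈ H) ∨ ∃ i, ε i = true ∧ a i ∈ H) := by
    intro ε H hH hxH hyH
    rw [hH.joinList_mem_iff hxH hyH, ← hQ]
    have : (∃ i j, i ≠ j ∧ a i ∈ H ∧ a j ∈ H) ↔ ∃ b ∈ P, b ∈ H := by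
      rw [hP]
      simp only [hH.m_mem_iff, hxH, false_and, and_false, false_or, or_false]
    rw [this, ← exists_or]
    simp only [List.mem_append, or_and_right]
  have hmor : ∀ ε₁ ε₂ ε₃ H, IsHalfspace H → x ∉ H → y ∈ H →
      (φ (m ε₁ ε₂ ε₃) ∈ H ↔ m (φ ε₁) (φ ε₂) (φ ε₃) ∈ H) := by
    intro ε₁ ε₂ ε₃ H hH hxH hyH
    rw [hH.m_mem_iff, hφ _ H hH hxH hyH, hφ _ H hH hxH hyH, hφ _ H hH hxH hyH,
      hφ _ H hH hxH hyH]
    by_cases hz : ∃ i j, i ≠ j ∧ a i ∈ H ∧ a j ∈ H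
    · simp [hz]
    simp only [hz, false_or]
    by_cases hi : ∃ i, a i ∈ H
    · obtain ⟨i, hi⟩ := hi
      have huniq : ∀ ε : Fin k → Bool, (∃ j, ε j = true ∧ a j ∈ H) ↔ ε i = true := by
        intro ε
        constructor
        · rintro ⟨j, hj, hjH⟩
          by_cases hij : i = j
          · rw [hij]; exact hj
          · exact absurd ⟨i, j, hij, hi, hjH⟩ hz
        · exact fun h => ⟨i, h, hi⟩
      simp only [huniq]
      change ((ε₁ i && ε₂ i) || (ε₂ i && ε₃ i) || (ε₃ i && ε₁ i)) = true ↔ _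
      simp [or_assoc]
    · push Not at hi
      simp [hi]
  refine ⟨φ, ?_, ?_⟩
  · intro ε₁ ε₂ hε
    have hval : ∀ ε i, φ ε ∈ h i ↔ ε i = true := by
      intro ε i
      rw [hφ ε _ (hh i) (hx i) (hy i)]
      constructor
      · rintro (⟨j, l, hjl, hj, hl⟩ | ⟨j, hj, hji⟩)
        · rw [ha] at hj hl
          exact absurd (hj.symm.trans hl) hjl
        · rw [ha] at hji
          rw [hji]; exact hj
      · exact fun h => Or.inr ⟨i, h, (ha i i).2 rfl⟩
    funext i
    have h1 := hval ε₁ i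
    rw [hε, hval] at h1
    exact (Bool.eq_iff_iff.2 h1).symm
  · intro ε₁ ε₂ ε₃
    apply eq_of_forall_isHalfspace
    intro H hH
    by_cases hxH : x ∈ H <;> by_cases hyH : y ∈ H
    · have h1 : ∀ ε, φ ε ∈ H := fun ε => hH.joinList_mem hxH hyH _
      simp [hH.m_mem_iff, h1]
    · have := hmor ε₁ ε₂ ε₃ Hᶜ hH.compl (fun h => h hxH) hyH
      simpa only [Set.mem_compl_iff, not_iff_not] using this
    · exact hmor ε₁ ε₂ ε₃ H hH hxH hyH
    · have h1 : ∀ ε, φ ε ∈ Hᶜ := fun ε => hH.compl.joinList_mem hxH hyH _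
      have h2 : ∀ ε, φ ε ∉ H := h1
      simp [hH.m_mem_iff, h2]

/-- The number `r` bounds the size of every set of pairwise transverse halfspaces. -/
def RankLE (M : Type*) [MedianAlgebra M] (r : ℕ) : Prop :=
  ∀ (k : ℕ) (h : Fin k → Set M), (∀ i, IsHalfspace (h i)) →
    (∀ i j, i ≠ j → Transverse (h i) (h j)) → k ≤ r

theorem exists_rankLE [Nonempty M] (hrank : rank M < ⊤) : ∃ r, RankLE M r := by
  obtain ⟨r, hr⟩ := ENat.ne_top_iff_exists.1 hrank.ne
  refine ⟨r, fun k h hh ht => ?_⟩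
  have h1 : (k : ℕ∞) ≤ rank M :=
    le_iSup₂_of_le (f := fun (k : ℕ) (_ : ContainsCube M k) => (k : ℕ∞)) k
      (containsCube_of_transverse h hh ht) le_rfl
  rw [← hr] at h1
  exact_mod_cast h1

theorem RankLE.finite {r : ℕ} (hr : RankLE M r) {T : Set (Set M)} (hT : ∀ h ∈ T, IsHalfspace h)
    (ht : ∀ h ∈ T, ∀ k ∈ T, h ≠ k → Transverse h k) : T.Finite ∧ T.ncard ≤ r := by
  have key : ∀ F : Finset (Set M), ↑F ⊆ T → F.card ≤ r := by
    intro F hF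
    refine hr F.card (fun i => (F.equivFin.symm i : Set M))
      (fun i => hT _ (hF (F.equivFin.symm i).2)) fun i j hij =>
      ht _ (hF (F.equivFin.symm i).2) _ (hF (F.equivFin.symm j).2) ?_
    intro he
    exact hij (F.equivFin.symm.injective (Subtype.ext he))
  have hfin : T.Finite := by
    by_contra hinf
    obtain ⟨F, hF, hcard⟩ := Set.Infinite.exists_subset_card_eq hinf (r + 1)
    have := key F hF
    omega
  refine ⟨hfin, ?_⟩
  rw [Set.ncard_eq_toFinset_card T hfin]
  exact key _ (by simp)

end Halfspaces

/-! ### Halfspaces not mapped strictly into themselves -/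

theorem exists_mem_subset_of_isChain {α ι : Type*} {c : Set (Set α)}
    (hc : IsChain (· ⊆ ·) c) (hne : c.Nonempty) (I : Finset ι) (f : ι → Set α)
    (hf : ∀ i ∈ I, f i ∈ c) : ∃ h ∈ c, ∀ i ∈ I, h ⊆ f i := by
  classical
  induction I using Finset.induction_on with
  | empty =>
    obtain ⟨h, hh⟩ := hne
    exact ⟨h, hh, by simp⟩
  | insert i I hi ih =>
    obtain ⟨h, hh, hI⟩ := ih fun j hj => hf j (by simp [hj])
    have hi' := hf i (by simp)
    rcases hc.total hh hi' with hle | hle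
    · exact ⟨h, hh, by simpa [hle] using hI⟩
    · exact ⟨f i, hi', by simpa using fun j hj => hle.trans (hI j hj)⟩

section SetActions

variable {G X : Type*} [Group G] [MulAction G X]

theorem Transverse.smul {h k : Set X} (hk : Transverse h k) (g : G) :
    Transverse (g • h) (g • k) := by
  unfold Transverse
  simp only [← Set.smul_set_compl, ← Set.smul_set_inter, Set.smul_set_nonempty]
  exact hk

variable (G) in
/-- The set `h` contains an orbit of the group. -/
def ContainsOrbit (h : Set X) : Prop :=
  ∃ z, ∀ g : G, g • z ∈ h

theorem inter_smul_nonempty {h : Set X} (hh : ∀ g : G, (g • h ∩ h).Nonempty) (a b : G) :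
    (a • h ∩ b • h).Nonempty := by
  have h1 := (hh (b⁻¹ * a)).smul_set (a := b)
  rw [Set.smul_set_inter, ← mul_smul, mul_inv_cancel_left] at h1
  exact h1

theorem ContainsOrbit.inter_nonempty {h : Set X} (hh : ContainsOrbit G h) (g : G) :
    (g • h ∩ h).Nonempty := by
  obtain ⟨z, hz⟩ := hh
  refine ⟨z, ?_, by simpa using hz 1⟩
  rw [Set.mem_smul_set_iff_inv_smul_mem]
  exact hz _

theorem ContainsOrbit.smul {h : Set X} (hh : ContainsOrbit G h) (a : G) :
    ContainsOrbit G (a • h) := by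
  obtain ⟨z, hz⟩ := hh
  refine ⟨z, fun g => ?_⟩
  rw [Set.mem_smul_set_iff_inv_smul_mem, ← mul_smul]
  exact hz _

end SetActions

section Actions

variable {G M : Type*} [Group G] [MedianAlgebra M] [MulAction G M]

theorem isConvex_smul [IsMedianAction G M] {C : Set M} (hC : IsConvex C) (g : G) :
    IsConvex (g • C) := by
  intro x hx y hy z
  rw [Set.mem_smul_set_iff_inv_smul_mem] at *
  rw [IsMedianAction.smul_m]
  exact hC _ hx _ hy _

theorem IsHalfspace.smul [IsMedianAction G M] {h : Set M} (hh : IsHalfspace h) (g : G) :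
    IsHalfspace (g • h) := by
  refine ⟨hh.1.smul_set, isConvex_smul hh.2.1 g, ?_, ?_⟩
  · rw [← Set.smul_set_compl]
    exact hh.2.2.1.smul_set
  · rw [← Set.smul_set_compl]
    exact isConvex_smul hh.2.2.2 g

variable (G) in
/-- A halfspace that no element of the group maps strictly into itself. -/
def IsNonskewered (h : Set M) : Prop :=
  IsHalfspace h ∧ ∀ g : G, ¬ g • h ⊂ h

theorem IsNonskewered.eq_of_subset {h : Set M} (hh : IsNonskewered G h) {a b : G}
    (hab : a • h ⊆ b • h) : a • h = b • h := by
  by_contra hne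
  refine hh.2 (b⁻¹ * a) ⟨?_, ?_⟩
  · rw [mul_smul, ← Set.subset_smul_set_iff]
    exact hab
  · intro hcon
    apply hne
    apply hab.antisymm
    rw [mul_smul, Set.subset_smul_set_iff, inv_inv] at hcon
    exact hcon

theorem IsNonskewered.compl {h : Set M} (hh : IsNonskewered G h) : IsNonskewered G hᶜ := by
  refine ⟨hh.1.compl, fun g hg => ?_⟩
  rw [Set.smul_set_compl] at hg
  have h1 : (1 : G) • h ⊆ g • h := by
    rw [one_smul]
    exact Set.compl_subset_compl.1 hg.1
  have h2 := hh.eq_of_subset h1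
  rw [one_smul] at h2
  exact hg.2 (Set.compl_subset_compl.2 h2.symm.subset)

theorem IsNonskewered.smul [IsMedianAction G M] {h : Set M} (hh : IsNonskewered G h) (a : G) :
    IsNonskewered G (a • h) := by
  refine ⟨hh.1.smul a, fun g hg => ?_⟩
  rw [← mul_smul] at hg
  exact hg.2 (hh.eq_of_subset hg.1).symm.subset

/-- Two distinct translates of a nonskewered halfspace whose translates pairwise intersect are
transverse as soon as both of them miss a common point. -/
theorem IsNonskewered.transverse {h : Set M} (hh : IsNonskewered G h)
    (hint : ∀ g : G, (g • h ∩ h).Nonempty) {z : M} {a b : G} (ha : z ∉ a • h) (hb : z ∉ b • h)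
    (hab : a • h ≠ b • h) : Transverse (a • h) (b • h) := by
  refine ⟨inter_smul_nonempty hint a b, ?_, ?_, ⟨z, ha, hb⟩⟩
  · rw [Set.inter_compl_nonempty_iff]
    exact fun hsub => hab (hh.eq_of_subset hsub)
  · rw [Set.inter_comm, Set.inter_compl_nonempty_iff]
    exact fun hsub => hab (hh.eq_of_subset hsub).symm

theorem IsNonskewered.finite_translates [IsMedianAction G M] {r : ℕ} (hr : RankLE M r)
    {h : Set M} (hh : IsNonskewered G h) (hint : ∀ g : G, (g • h ∩ h).Nonempty) (z : M) :
    {k | ∃ g : G, k = g • h ∧ z ∉ k}.Finite ∧ {k | ∃ g : G, k = g • h ∧ z ∉ k}.ncard ≤ r := by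
  apply hr.finite
  · rintro _ ⟨g, rfl, -⟩
    exact hh.1.smul g
  · rintro _ ⟨a, rfl, ha⟩ _ ⟨b, rfl, hb⟩ hab
    exact hh.transverse hint ha hb hab

/-- In finite rank, the intersection of a chain of nonskewered halfspaces is nonskewered, as soon
as both it and its complement contain a point common to the whole chain. -/
theorem isNonskewered_sInter [IsMedianAction G M] {r : ℕ} (hr : RankLE M r) {c : Set (Set M)}
    (hc : ∀ h ∈ c, IsNonskewered G h) (hchain : IsChain (· ⊆ ·) c) (hne : c.Nonempty) {x y : M}
    (hx : ∀ h ∈ c, x ∈ h) (hy : ∀ h ∈ c, y ∉ h) : IsNonskewered G (⋂₀ c) := by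
  obtain ⟨h₀, hh₀⟩ := hne
  have hyk : y ∉ ⋂₀ c := fun hcon => hy h₀ hh₀ (hcon h₀ hh₀)
  refine ⟨⟨⟨x, hx⟩, isConvex_sInter fun h hh => (hc h hh).1.2.1, ⟨y, hyk⟩,
    isConvex_compl_sInter_of_isChain (fun h hh => (hc h hh).1.2.2.2) hchain⟩, ?_⟩
  intro g hg
  obtain ⟨q, hqk, hqg⟩ := Set.exists_of_ssubset hg
  have hpow : ∀ n : ℕ, g ^ (n + 1) • ⋂₀ c ⊆ g • ⋂₀ c := by
    intro n
    induction n with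
    | zero => simp
    | succ n ih =>
      rw [pow_succ', mul_smul]
      exact Set.smul_set_mono (ih.trans hg.1)
  have hmiss : ∀ p, p ∉ g • ⋂₀ c → ∀ n : ℕ, ∃ h ∈ c, p ∉ g ^ (n + 1) • h := by
    intro p hp n
    have h1 : p ∉ g ^ (n + 1) • ⋂₀ c := fun hcon => hp (hpow n hcon)
    rw [Set.mem_smul_set_iff_inv_smul_mem, Set.mem_sInter] at h1
    push Not at h1
    obtain ⟨h, hh, hph⟩ := h1
    exact ⟨h, hh, by rwa [Set.mem_smul_set_iff_inv_smul_mem]⟩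
  choose f hfc hf using hmiss q hqg
  choose f' hfc' hf' using hmiss y fun hcon => hyk (hg.1 hcon)
  obtain ⟨h₁, hh₁, hle₁⟩ := exists_mem_subset_of_isChain hchain ⟨h₀, hh₀⟩ (Finset.range r) f
    fun i _ => hfc i
  obtain ⟨h₂, hh₂, hle₂⟩ := exists_mem_subset_of_isChain hchain ⟨h₀, hh₀⟩ (Finset.range r) f'
    fun i _ => hfc' i
  obtain ⟨h, hh, hle⟩ : ∃ h ∈ c, h ⊆ h₁ ∧ h ⊆ h₂ := by
    rcases hchain.total hh₁ hh₂ with hle | hle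
    · exact ⟨h₁, hh₁, subset_rfl, hle⟩
    · exact ⟨h₂, hh₂, hle, subset_rfl⟩
  -- Far down the chain, `h` and its first `r` translates by powers of `g` are transverse.
  have htrans : ∀ n < r, Transverse h (g ^ (n + 1) • h) := by
    intro n hn
    have hq : q ∉ g ^ (n + 1) • h := fun hcon =>
      hf n (Set.smul_set_mono (hle.1.trans (hle₁ n (Finset.mem_range.2 hn))) hcon)
    have hy' : y ∉ g ^ (n + 1) • h := fun hcon =>
      hf' n (Set.smul_set_mono (hle.2.trans (hle₂ n (Finset.mem_range.2 hn))) hcon)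
    refine ⟨⟨g ^ (n + 1) • x, ?_, Set.smul_mem_smul_set (hx h hh)⟩, ⟨q, hqk h hh, hq⟩, ?_,
      ⟨y, hy h hh, hy'⟩⟩
    · exact hg.1 (hpow n (Set.smul_mem_smul_set hx)) h hh
    · rw [Set.inter_comm, Set.inter_compl_nonempty_iff]
      exact fun hsub => (hc h hh).2 _ ⟨hsub, fun hcon => hq (hcon (hqk h hh))⟩
  have hlt : ∀ i j : ℕ, i < j → j ≤ r → Transverse (g ^ i • h) (g ^ j • h) := by
    intro i j hij hj
    have h1 := (htrans (j - i - 1) (by omega)).smul (g ^ i)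
    rw [← mul_smul, ← pow_add, show i + (j - i - 1 + 1) = j by omega] at h1
    exact h1
  have hcard := hr (r + 1) (fun i => g ^ (i : ℕ) • h) (fun i => (hc h hh).1.smul _) (by
    intro i j hij
    have hij' : (i : ℕ) ≠ j := fun hcon => hij (Fin.ext hcon)
    rcases lt_or_gt_of_ne hij' with hlt' | hlt'
    · exact hlt i j hlt' (by omega)
    · exact (hlt j i hlt' (by omega)).symm)
  omega

/-! ### Halfspaces containing an orbit -/

theorem IsNonskewered.containsOrbit_of_inter [IsMedianAction G M] [Nonempty M] {r : ℕ}
    (hr : RankLE M r) {h : Set M} (hh : IsNonskewered G h)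
    (hint : ∀ g : G, (g • h ∩ h).Nonempty) : ContainsOrbit G h := by
  classical
  have hfin := fun z => (hh.finite_translates hr hint z).1
  have hpair : ∀ k ∈ {k | ∃ g : G, k = g • h}, ∀ l ∈ {k | ∃ g : G, k = g • h},
      (k ∩ l).Nonempty := by
    rintro _ ⟨a, rfl⟩ _ ⟨b, rfl⟩
    exact inter_smul_nonempty hint a b
  have hconv : ∀ k ∈ {k | ∃ g : G, k = g • h}, IsConvex k := by
    rintro _ ⟨a, rfl⟩
    exact isConvex_smul hh.1.2.1 a
  have hmem : ∀ z, ∀ k ∈ (hfin z).toFinset, k ∈ {k | ∃ g : G, k = g • h} := by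
    intro z k hk
    obtain ⟨g, hg, -⟩ := (hfin z).mem_toFinset.1 hk
    exact ⟨g, hg⟩
  let x : M := Classical.arbitrary M
  -- `z` lies in all translates that miss `x`, and `w` in all that miss `x` or `z`: every
  -- translate contains two of the three points `x`, `z`, `w`.
  obtain ⟨z, hz⟩ := helly (hfin x).toFinset id (fun k hk => hconv k (hmem x k hk))
    fun k hk l hl => hpair k (hmem x k hk) l (hmem x l hl)
  have hmem' : ∀ k ∈ (hfin x).toFinset ∪ (hfin z).toFinset, k ∈ {k | ∃ g : G, k = g • h} := by
    intro k hk
    rcases Finset.mem_union.1 hk with hk | hk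
    · exact hmem x k hk
    · exact hmem z k hk
  obtain ⟨w, hw⟩ := helly ((hfin x).toFinset ∪ (hfin z).toFinset) id
    (fun k hk => hconv k (hmem' k hk)) fun k hk l hl => hpair k (hmem' k hk) l (hmem' l hl)
  have hz' : ∀ g : G, x ∉ g • h → z ∈ g • h := fun g hg =>
    hz _ ((hfin x).mem_toFinset.2 ⟨g, rfl, hg⟩)
  have hw' : ∀ g : G, x ∉ g • h ∨ z ∉ g • h → w ∈ g • h := by
    rintro g (hg | hg)
    · exact hw _ (Finset.mem_union_left _ ((hfin x).mem_toFinset.2 ⟨g, rfl, hg⟩))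
    · exact hw _ (Finset.mem_union_right _ ((hfin z).mem_toFinset.2 ⟨g, rfl, hg⟩))
  refine ⟨m x z w, fun g => ?_⟩
  have h1 : m x z w ∈ g⁻¹ • h := by
    rw [(hh.1.smul g⁻¹).m_mem_iff]
    have h2 := hz' g⁻¹
    have h3 := hw' g⁻¹
    tauto
  rwa [Set.mem_smul_set_iff_inv_smul_mem, inv_inv] at h1

/-- Without wall inversions, one side of every nonskewered halfspace contains an orbit. -/
theorem IsNonskewered.containsOrbit_or [IsMedianAction G M] [Nonempty M] {r : ℕ}
    (hr : RankLE M r) (hinv : WithoutWallInversions G M) {h : Set M}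
    (hh : IsNonskewered G h) : ContainsOrbit G h ∨ ContainsOrbit G hᶜ := by
  by_cases hint : ∀ g : G, (g • h ∩ h).Nonempty
  · exact Or.inl (hh.containsOrbit_of_inter hr hint)
  right
  push Not at hint
  obtain ⟨g, hg⟩ := hint
  have hg1 : g • h ⊆ hᶜ :=
    Set.subset_compl_iff_disjoint_right.2 (Set.disjoint_iff_inter_eq_empty.2 hg)
  refine hh.compl.containsOrbit_of_inter hr fun a => ?_
  by_contra hcon
  rw [Set.not_nonempty_iff_eq_empty, ← Set.disjoint_iff_inter_eq_empty,
    ← Set.subset_compl_iff_disjoint_left, Set.smul_set_compl, compl_compl] at hcon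
  have h1 := hh.eq_of_subset (hg1.trans hcon)
  exact hinv h hh.1 g (hg1.antisymm (h1 ▸ hcon))

/-- Within `r` steps, a growing sequence of balls of a finitely generated group either covers the
orbit of a point or reaches more than `r` of its points. -/
theorem exists_finset_orbit (G : Type*) [Group G] [Group.FG G] (X : Type*) [MulAction G X]
    (r : ℕ) : ∃ F : Finset G, ∀ x : X, ((fun f : G => f • x) '' F).ncard ≤ r →
      ∀ g : G, ∃ f ∈ F, f • x = g • x := by
  classical
  obtain ⟨S, hS⟩ := (Group.FG.out : (⊤ : Subgroup G).FG)
  let B : Finset G := insert 1 S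
  refine ⟨B ^ r, fun x => ?_⟩
  let T : ℕ → Set X := fun n => (fun f : G => f • x) '' ((B ^ n : Finset G) : Set G)
  have hfin : ∀ n, (T n).Finite := fun n => (Finset.finite_toSet _).image _
  have hstep : ∀ n, ∀ b ∈ B, ∀ y ∈ T n, b • y ∈ T (n + 1) := by
    rintro n b hb _ ⟨f, hf, rfl⟩
    refine ⟨b * f, ?_, mul_smul b f x⟩
    rw [pow_succ']
    exact Finset.mul_mem_mul hb hf
  have hmono : ∀ n, T n ⊆ T (n + 1) := fun n y hy => by
    simpa using hstep n 1 (Finset.mem_insert_self 1 S) y hy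
  have hx : ∀ n, x ∈ T n := by
    intro n
    induction n with
    | zero => exact ⟨1, by simp, one_smul G x⟩
    | succ n ih => exact hmono n ih
  have key : ∀ n, (∀ g : G, g • x ∈ T n) ∨ n + 1 ≤ (T n).ncard := by
    intro n
    induction n with
    | zero =>
      right
      exact (Set.ncard_pos (hfin 0)).2 ⟨x, hx 0⟩
    | succ n ih =>
      rcases ih with ih | ih
      · exact Or.inl fun g => hmono n (ih g)
      by_cases heq : T n = T (n + 1)
      · left
        have hstab : MulAction.stabilizer G (T n) = ⊤ := by
          rw [eq_top_iff, ← hS, Subgroup.closure_le]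
          intro s hs
          have hsub : s • T n ⊆ T n := by
            rintro _ ⟨y, hy, rfl⟩
            rw [heq]
            exact hstep n s (Finset.mem_insert_of_mem hs) y hy
          exact MulAction.mem_stabilizer_iff.2
            (Set.eq_of_subset_of_ncard_le hsub (by rw [Set.ncard_smul_set]) (hfin n))
        intro g
        have hg : g • T n = T n := by
          rw [← MulAction.mem_stabilizer_iff, hstab]
          trivial
        rw [← heq, ← hg]
        exact Set.smul_mem_smul_set (hx n)
      · right
        have := Set.ncard_lt_ncard ((hmono n).ssubset_of_ne heq) (hfin (n + 1))
        omega
  intro hcard g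
  rcases key r with h | h
  · obtain ⟨f, hf, hfg⟩ := h g
    exact ⟨f, hf, hfg⟩
  · have : (T r).ncard ≤ r := hcard
    omega

variable (G M) in
/-- The finite set `F` detects orbits: an orbit that meets a nonskewered halfspace whose
translates pairwise intersect does so at a translate by an element of `F`, from any base point. -/
def DetectsOrbits (F : Finset G) : Prop :=
  ∀ h : Set M, IsNonskewered G h → (∀ g : G, (g • h ∩ h).Nonempty) →
    ∀ (z : M) (g : G), g • z ∈ h → ∃ f ∈ F, f • z ∈ h

theorem exists_detectsOrbits [Group.FG G] [IsMedianAction G M] {r : ℕ} (hr : RankLE M r) :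
    ∃ F : Finset G, DetectsOrbits G M F := by
  classical
  obtain ⟨F, hF⟩ := exists_finset_orbit G (Set M) r
  refine ⟨F.image (·⁻¹), fun h hh hint z g hgz => ?_⟩
  by_contra hcon
  push Not at hcon
  have hz : ∀ f ∈ F, z ∉ f • h := by
    intro f hf
    rw [Set.mem_smul_set_iff_inv_smul_mem]
    exact hcon f⁻¹ (Finset.mem_image_of_mem _ hf)
  obtain ⟨hfin, hcard⟩ := hh.finite_translates hr hint z
  obtain ⟨f, hf, hfg⟩ := hF h ((Set.ncard_le_ncard (by
    rintro _ ⟨f, hf, rfl⟩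
    exact ⟨f, rfl, hz f hf⟩) hfin).trans hcard) g⁻¹
  apply hz f hf
  rw [hfg, Set.mem_smul_set_iff_inv_smul_mem, inv_inv]
  exact hgz

/-- If the complement of the intersection of a chain contains an orbit, then so does the complement
of some member of the chain. -/
theorem DetectsOrbits.containsOrbit_compl_of_sInter {F : Finset G} (hF : DetectsOrbits G M F)
    {c : Set (Set M)} (hc : ∀ h ∈ c, IsNonskewered G h ∧ ContainsOrbit G h)
    (hchain : IsChain (· ⊆ ·) c) (hne : c.Nonempty) (hk : ContainsOrbit G (⋂₀ c)ᶜ) :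
    ∃ h ∈ c, ContainsOrbit G hᶜ := by
  obtain ⟨z, hz⟩ := hk
  have hex : ∀ f : G, ∃ h ∈ c, f • z ∉ h := by
    intro f
    have := hz f
    rw [Set.mem_compl_iff, Set.mem_sInter] at this
    push Not at this
    exact this
  choose k hkc hk using hex
  obtain ⟨h, hh, hle⟩ := exists_mem_subset_of_isChain hchain hne F k fun f _ => hkc f
  refine ⟨h, hh, z, fun g hg => ?_⟩
  obtain ⟨f, hf, hfz⟩ := hF h (hc h hh).1 (hc h hh).2.inter_nonempty z g hg
  exact hk f (hle f hf hfz)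

end Actions

/-! ### Halfspaces crossing an orbit -/

section Crossing

variable {G M : Type*} [Group G] [MedianAlgebra M] [MulAction G M]

variable (G) in
/-- The nonskewered halfspaces that separate two points of the orbit of `x`. -/
def crossing (x : M) : Set (Set M) :=
  {h | IsNonskewered G h ∧ (∃ g : G, g • x ∈ h) ∧ ∃ g : G, g • x ∉ h}

theorem compl_mem_crossing {x : M} {h : Set M} (hh : h ∈ crossing G x) :
    hᶜ ∈ crossing G x := by
  obtain ⟨h1, h2, g, hg⟩ := hh
  exact ⟨h1.compl, ⟨g, hg⟩, by simpa using h2⟩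

theorem smul_mem_crossing [IsMedianAction G M] {x : M} {h : Set M} (hh : h ∈ crossing G x)
    (a : G) : a • h ∈ crossing G x := by
  obtain ⟨h1, ⟨g, hg⟩, g', hg'⟩ := hh
  refine ⟨h1.smul a, ⟨a * g, ?_⟩, a * g', ?_⟩
  · rw [mul_smul]
    exact Set.smul_mem_smul_set hg
  · rwa [mul_smul, Set.smul_mem_smul_set_iff]

/-- The point `y` is obtained from `x` by a projection towards the orbit of `z`: with `F` detecting
orbits, `y` is the gate of `x` in the convex hull of `z` and the translates of `z` by `F`. -/
theorem DetectsOrbits.exists_crossing_subset [IsMedianAction G M] {F : Finset G}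
    (hF : DetectsOrbits G M F) (x z : M) :
    ∃ y : M, crossing G y ⊆ crossing G x ∩ crossing G z := by
  set l := F.toList.map fun f => f • z with hl
  have hmem : ∀ a, a ∈ l ↔ ∃ f ∈ F, f • z = a := by
    intro a
    simp [hl]
  set y := joinList z x l with hy
  have hgate : ∀ {H : Set M}, IsHalfspace H → x ∈ H → (∃ f ∈ F, f • z ∈ H) → y ∈ H := by
    rintro H hH hx ⟨f, hf, hfz⟩
    by_cases hz : z ∈ H
    · exact hH.joinList_mem hz hx l
    · exact (hH.joinList_mem_iff hz hx l).2 ⟨f • z, (hmem _).2 ⟨f, hf, rfl⟩, hfz⟩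
  have hhull : ∀ {H : Set M}, IsHalfspace H → (∀ g : G, g • z ∈ H) → y ∈ H := by
    intro H hH hz
    have hz1 : z ∈ H := by simpa using hz 1
    by_cases hx : x ∈ H
    · exact hH.joinList_mem hz1 hx l
    · by_contra hcon
      obtain ⟨a, ha, haH⟩ := (hH.compl.joinList_mem_iff (fun hz' => hz' hz1) hx l).1 hcon
      obtain ⟨f, -, rfl⟩ := (hmem a).1 ha
      exact haH (hz f)
  have hsmul : ∀ (a : G) (H : Set M), y ∈ a⁻¹ • H → a • y ∈ H := by
    intro a H h1
    rwa [Set.mem_smul_set_iff_inv_smul_mem, inv_inv] at h1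
  have hz : ∀ {h : Set M}, IsNonskewered G h → (∀ g : G, g • z ∈ h) → ∀ a : G, a • y ∈ h := by
    intro h hh hgz a
    apply hsmul
    apply hhull (hh.1.smul a⁻¹)
    intro g
    rw [Set.mem_smul_set_iff_inv_smul_mem, inv_inv, ← mul_smul]
    exact hgz _
  have hx : ∀ {h : Set M}, (∀ g : G, g • x ∈ h) → h ∉ crossing G y := by
    intro h hgx hcross
    have hh := hcross.1
    by_cases hgz : ∃ g : G, g • z ∈ h
    · obtain ⟨g, hg⟩ := hgz
      obtain ⟨a, ha⟩ := hcross.2.2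
      have hxa : ∀ b : G, b • x ∈ a⁻¹ • h := by
        intro b
        rw [Set.mem_smul_set_iff_inv_smul_mem, inv_inv, ← mul_smul]
        exact hgx _
      refine ha (hsmul a h (hgate (hh.1.smul a⁻¹) (by simpa using hxa 1) ?_))
      refine hF _ (hh.smul a⁻¹) (ContainsOrbit.inter_nonempty ⟨x, hxa⟩) z (a⁻¹ * g) ?_
      rw [mul_smul]
      exact Set.smul_mem_smul_set hg
    · push Not at hgz
      obtain ⟨a, ha⟩ := hcross.2.1
      exact hz hh.compl hgz a ha
  refine ⟨y, fun h hcross => ⟨⟨hcross.1, ?_, ?_⟩, ⟨hcross.1, ?_, ?_⟩⟩⟩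
  · by_contra hcon
    push Not at hcon
    exact hx (h := hᶜ) hcon (compl_mem_crossing hcross)
  · by_contra hcon
    push Not at hcon
    exact hx hcon hcross
  · by_contra hcon
    push Not at hcon
    obtain ⟨a, ha⟩ := hcross.2.1
    exact hz hcross.1.compl hcon a ha
  · by_contra hcon
    push Not at hcon
    obtain ⟨a, ha⟩ := hcross.2.2
    exact ha (hz hcross.1 hcon a)

theorem DetectsOrbits.exists_crossing_subset_of_finset [IsMedianAction G M] {F : Finset G}
    (hF : DetectsOrbits G M F) (x : M) (Z : Finset M) :
    ∃ y : M, crossing G y ⊆ crossing G x ∧ ∀ z ∈ Z, crossing G y ⊆ crossing G z := by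
  classical
  induction Z using Finset.induction_on with
  | empty => exact ⟨x, subset_rfl, by simp⟩
  | insert z Z _ ih =>
    obtain ⟨y, hyx, hyZ⟩ := ih
    obtain ⟨w, hw⟩ := hF.exists_crossing_subset y z
    rw [Set.subset_inter_iff] at hw
    refine ⟨w, hw.1.trans hyx, fun u hu => ?_⟩
    rcases Finset.mem_insert.1 hu with rfl | hu
    · exact hw.2
    · exact hw.1.trans (hyZ u hu)

/-- A family of halfspaces separating `x` from `y` that is closed under intersections of chains has
only finitely many minimal members, since these are pairwise transverse. -/
theorem RankLE.exists_finset_containsOrbit {r : ℕ} (hr : RankLE M r) {Q : Set (Set M)} {x y : M}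
    (hQ : ∀ h ∈ Q, IsHalfspace h ∧ x ∈ h ∧ y ∉ h ∧ ContainsOrbit G h)
    (hchain : ∀ c ⊆ Q, IsChain (· ⊆ ·) c → c.Nonempty → ⋂₀ c ∈ Q) :
    ∃ Z : Finset M, ∀ h ∈ Q, ∃ z ∈ Z, ∀ g : G, g • z ∈ h := by
  classical
  have hfin : {k | Minimal (· ∈ Q) k}.Finite := by
    refine (hr.finite (fun h hh => (hQ h hh.prop).1) ?_).1
    intro h hh k hk hne
    obtain ⟨-, hxh, hyh, -⟩ := hQ h hh.prop
    obtain ⟨-, hxk, hyk, -⟩ := hQ k hk.prop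
    refine ⟨⟨x, hxh, hxk⟩, ?_, ?_, ⟨y, hyh, hyk⟩⟩
    · rw [Set.inter_compl_nonempty_iff]
      exact fun hsub => hne (hsub.antisymm (hk.le_of_le hh.prop hsub))
    · rw [Set.inter_comm, Set.inter_compl_nonempty_iff]
      exact fun hsub => hne ((hh.le_of_le hk.prop hsub).antisymm hsub)
  have hpt : ∀ k, ∃ z : M, k ∈ Q → ∀ g : G, g • z ∈ k := by
    intro k
    by_cases hk : k ∈ Q
    · obtain ⟨z, hz⟩ := (hQ k hk).2.2.2
      exact ⟨z, fun _ => hz⟩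
    · exact ⟨x, fun hk' => absurd hk' hk⟩
  choose p hp using hpt
  refine ⟨hfin.toFinset.image p, fun h hh => ?_⟩
  obtain ⟨k, hkh, hk⟩ := zorn_superset_nonempty Q
    (fun c hc hcc hne => ⟨⋂₀ c, hchain c hc hcc hne, fun s hs => Set.sInter_subset_of_mem hs⟩) h hh
  exact ⟨p k, Finset.mem_image_of_mem _ (hfin.mem_toFinset.2 hk), fun g => hkh (hp k hk.prop g)⟩

/-- Some translate of a halfspace crossing the orbit of `x` separates `x` from its image under a
generator or the inverse of a generator. -/
theorem exists_smul_separating {S : Set G} (hS : Subgroup.closure S = ⊤) {x : M} {h : Set M}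
    (hh : h ∈ crossing G x) :
    ∃ g s : G, (s ∈ S ∨ s⁻¹ ∈ S) ∧ x ∈ g • h ∧ s • x ∉ g • h := by
  by_contra hcon
  push Not at hcon
  have hgen : ∀ s ∈ S, ∀ g : G, x ∈ g • h ↔ s • x ∈ g • h := by
    intro s hs g
    refine ⟨hcon g s (Or.inl hs), fun hsx => ?_⟩
    have h1 := hcon (s⁻¹ * g) s⁻¹ (Or.inr (by rwa [inv_inv]))
    simp only [mul_smul, Set.smul_mem_smul_set_iff] at h1
    exact h1 (by rwa [Set.mem_smul_set_iff_inv_smul_mem, inv_inv])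
  have hall : ∀ a : G, ∀ g : G, x ∈ g • h ↔ a • x ∈ g • h := by
    intro a
    have ha : a ∈ Subgroup.closure S := hS ▸ Subgroup.mem_top a
    induction ha using Subgroup.closure_induction with
    | mem s hs => exact hgen s hs
    | one => simp
    | mul a b _ _ iha ihb =>
      intro g
      have h1 := ihb (a⁻¹ * g)
      have h2 := iha g
      simp only [Set.mem_smul_set_iff_inv_smul_mem, mul_smul, inv_inv] at *
      tauto
    | inv a _ iha =>
      intro g
      have h1 := iha (a * g)
      simp only [Set.mem_smul_set_iff_inv_smul_mem, mul_smul, inv_smul_smul] at *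
      tauto
  obtain ⟨-, ⟨a, ha⟩, b, hb⟩ := hh
  have h1 := hall a 1
  have h2 := hall b 1
  rw [one_smul] at h1 h2
  exact hb (h2.1 (h1.2 ha))

/-- Let `P` be an invariant family of halfspaces containing orbits, closed under intersections of
chains of halfspaces that separate `x` from one of its translates. Then `x` can be replaced by a
point whose orbit is not crossed by the members of `P`, and not crossed by new halfspaces. -/
theorem DetectsOrbits.exists_crossing_disjoint [Group.FG G] [IsMedianAction G M] {r : ℕ}
    (hr : RankLE M r) {F : Finset G} (hF : DetectsOrbits G M F) (x : M) {P : Set (Set M)}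
    (hP : ∀ h ∈ P, IsHalfspace h ∧ ContainsOrbit G h) (hsmul : ∀ h ∈ P, ∀ g : G, g • h ∈ P)
    (hchain : ∀ (s : G), ∀ c ⊆ {h ∈ P | x ∈ h ∧ s • x ∉ h}, IsChain (· ⊆ ·) c → c.Nonempty →
      ⋂₀ c ∈ P) :
    ∃ y : M, crossing G y ⊆ crossing G x ∧ Disjoint (crossing G y) P := by
  classical
  obtain ⟨S, hS⟩ := (Group.FG.out : (⊤ : Subgroup G).FG)
  have hex : ∀ s : G, ∃ Z : Finset M, ∀ h ∈ {h ∈ P | x ∈ h ∧ s • x ∉ h},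
      ∃ z ∈ Z, ∀ g : G, g • z ∈ h := by
    intro s
    refine hr.exists_finset_containsOrbit (x := x) (y := s • x)
      (fun h hh => ⟨(hP h hh.1).1, hh.2.1, hh.2.2, (hP h hh.1).2⟩) ?_
    rintro c hc hcc ⟨h₀, hh₀⟩
    exact ⟨hchain s c hc hcc ⟨h₀, hh₀⟩, fun h hh => (hc hh).2.1,
      fun hcon => (hc hh₀).2.2 (hcon h₀ hh₀)⟩
  choose Z hZ using hex
  obtain ⟨y, hyx, hy⟩ := hF.exists_crossing_subset_of_finset x ((S ∪ S.image (·⁻¹)).biUnion Z)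
  refine ⟨y, hyx, Set.disjoint_left.2 fun h hh hhP => ?_⟩
  obtain ⟨g, s, hs, hx, hsx⟩ := exists_smul_separating hS (hyx hh)
  obtain ⟨z, hz, hgz⟩ := hZ s (g • h) ⟨hsmul h hhP g, hx, hsx⟩
  have hs' : s ∈ S ∪ S.image (·⁻¹) := by
    rcases hs with hs | hs
    · exact Finset.mem_union_left _ hs
    · exact Finset.mem_union_right _ (Finset.mem_image.2 ⟨s⁻¹, hs, inv_inv s⟩)
  obtain ⟨-, -, a, ha⟩ := hy z (Finset.mem_biUnion.2 ⟨s, hs', hz⟩) (smul_mem_crossing hh g)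
  exact ha (hgz a)

/-- There is an orbit crossed only by halfspaces that some group element maps strictly into
themselves. -/
theorem exists_crossing_eq_empty [Group.FG G] [IsMedianAction G M] [Nonempty M] {r : ℕ}
    (hr : RankLE M r) (hinv : WithoutWallInversions G M) : ∃ y : M, crossing G y = ∅ := by
  obtain ⟨F, hF⟩ := exists_detectsOrbits (G := G) hr
  -- First remove the halfspaces whose complement contains no orbit.
  let P : Set (Set M) := {h | IsNonskewered G h ∧ ¬ ContainsOrbit G hᶜ}
  have hPorb : ∀ h ∈ P, ContainsOrbit G h := fun h hh =>
    (hh.1.containsOrbit_or hr hinv).resolve_right hh.2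
  obtain ⟨x, -, hx⟩ := hF.exists_crossing_disjoint hr (Classical.arbitrary M) (P := P)
    (fun h hh => ⟨hh.1.1, hPorb h hh⟩) (by
      refine fun h hh g => ⟨hh.1.smul g, fun hcon => hh.2 ?_⟩
      have h1 := hcon.smul g⁻¹
      rwa [Set.smul_set_compl, inv_smul_smul] at h1) (by
      intro s c hc hcc hne
      refine ⟨isNonskewered_sInter hr (fun h hh => (hc hh).1.1) hcc hne
        (fun h hh => (hc hh).2.1) (fun h hh => (hc hh).2.2), fun hcon => ?_⟩
      obtain ⟨h, hh, hho⟩ := hF.containsOrbit_compl_of_sInter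
        (fun h hh => ⟨(hc hh).1.1, hPorb h (hc hh).1⟩) hcc hne hcon
      exact (hc hh).1.2 hho)
  -- Now both sides of each halfspace crossing the orbit of `x` contain orbits.
  obtain ⟨y, hyx, hy⟩ := hF.exists_crossing_disjoint hr x (P := crossing G x) (by
      refine fun h hh => ⟨hh.1.1, ?_⟩
      by_contra hcon
      refine Set.disjoint_left.1 hx (compl_mem_crossing hh) ⟨hh.1.compl, ?_⟩
      rwa [compl_compl])
    (fun h hh g => smul_mem_crossing hh g) (by
      rintro s c hc hcc ⟨h₀, hh₀⟩
      refine ⟨isNonskewered_sInter hr (fun h hh => (hc hh).1.1) hcc ⟨h₀, hh₀⟩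
        (fun h hh => (hc hh).2.1) (fun h hh => (hc hh).2.2), ⟨1, ?_⟩, s, ?_⟩
      · rw [one_smul]
        exact fun h hh => (hc hh).2.1
      · exact fun hcon => (hc hh₀).2.2 (hcon h₀ hh₀))
  exact ⟨y, Set.eq_empty_of_forall_notMem fun h hh => Set.disjoint_left.1 hy hh (hyx hh)⟩

/-! ### The essential core -/

variable (G) in
/-- The intersection of all halfspaces containing the orbit of `y`. -/
def orbitHull [IsMedianAction G M] (y : M) : InvariantConvexSubset G M where
  carrier := ⋂₀ {h | IsHalfspace h ∧ ∀ g : G, g • y ∈ h}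
  smul_mem' := by
    rintro a p hp h ⟨hh, hy⟩
    have h1 : p ∈ a⁻¹ • h := hp _ ⟨hh.smul a⁻¹, fun g => by
      rw [Set.mem_smul_set_iff_inv_smul_mem, inv_inv, ← mul_smul]
      exact hy _⟩
    rwa [Set.mem_smul_set_iff_inv_smul_mem, inv_inv] at h1
  isConvex' := isConvex_sInter fun _ hh => hh.1.2.1

theorem mem_orbitHull [IsMedianAction G M] {y p : M} :
    p ∈ orbitHull G y ↔ ∀ h, IsHalfspace h → (∀ g : G, g • y ∈ h) → p ∈ h :=
  ⟨fun hp h hh hy => hp h ⟨hh, hy⟩, fun hp h hh => hp h hh.1 hh.2⟩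

/-- Every halfspace of an invariant convex subset `C` is the trace of a halfspace of `M`. -/
theorem InvariantConvexSubset.exists_isHalfspace_preimage (C : InvariantConvexSubset G M)
    {k : Set C} (hk : IsHalfspace k) : ∃ h : Set M, IsHalfspace h ∧ k = (↑) ⁻¹' h := by
  have himage : ∀ {l : Set C}, IsConvex l → IsConvex ((↑) '' l : Set M) := by
    rintro l hl _ ⟨a, ha, rfl⟩ _ ⟨b, hb, rfl⟩ z
    -- `m a b z` is also the median of `a`, `b` and the point `m a b z` of `C`.
    have h1 := hl a ha b hb (m a b ⟨m a b z, C.isConvex' a a.2 b b.2 z⟩)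
    refine ⟨_, h1, ?_⟩
    change m (a : M) b (m (a : M) b (m (a : M) b z)) = m (a : M) b z
    rw [show m (a : M) b (m (a : M) b z) = m (a : M) b z by
      rw [← m_inf_assoc, m_inf_self]]
    rw [← m_inf_assoc, m_inf_self]
  obtain ⟨h, hh, hkh, hkh'⟩ := exists_isHalfspace_separating (himage hk.2.1) (himage hk.2.2.2)
    (hk.1.image _) (hk.2.2.1.image _)
    ((Set.disjoint_image_iff Subtype.val_injective).2 disjoint_compl_right)
  refine ⟨h, hh, Set.Subset.antisymm (fun c hc => hkh ⟨c, hc, rfl⟩) fun c hc => ?_⟩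
  by_contra hcon
  exact hkh' ⟨c, hcon, rfl⟩ hc

theorem isEssential_orbitHull [IsMedianAction G M] {y : M} (hy : crossing G y = ∅) :
    IsEssential G (orbitHull G y) := by
  intro k hk
  obtain ⟨h, hh, rfl⟩ := InvariantConvexSubset.exists_isHalfspace_preimage _ hk
  obtain ⟨a, ha⟩ := hk.1
  obtain ⟨b, hb⟩ := hk.2.2.1
  replace ha : (a : M) ∈ h := ha
  replace hb : (b : M) ∉ h := hb
  by_cases hns : IsNonskewered G h
  · exfalso
    have hcross : h ∉ crossing G y := by simp [hy]
    by_cases hgy : ∀ g : G, g • y ∈ h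
    · exact hb (mem_orbitHull.1 b.2 h hh hgy)
    · push Not at hgy
      refine mem_orbitHull.1 a.2 hᶜ hh.compl (fun g hg => hcross ⟨hns, ⟨g, hg⟩, hgy⟩) ha
  have hsk : ∃ g : G, g • h ⊂ h := by
    by_contra hcon
    push Not at hcon
    exact hns ⟨hh, hcon⟩
  obtain ⟨g, hg⟩ := hsk
  refine ⟨g, ?_, fun hcon => ?_⟩
  · rintro _ ⟨c, hc, rfl⟩
    exact hg.1 (Set.smul_mem_smul_set hc)
  · obtain ⟨p, hp, hpg⟩ := Set.exists_of_ssubset hg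
    -- The median of `a`, `b` and `p` lies in the core and in `h`, but not in `g • h`.
    have hag : (a : M) ∈ g • h := by
      obtain ⟨c, hc, hca⟩ := hcon (show a ∈ ((↑) ⁻¹' h : Set (orbitHull G y)) from ha)
      rw [← hca]
      exact Set.smul_mem_smul_set hc
    let q : orbitHull G y := ⟨m (a : M) b p, (orbitHull G y).isConvex' a a.2 b b.2 p⟩
    have hq : q ∈ ((↑) ⁻¹' h : Set (orbitHull G y)) :=
      (hh.m_mem_iff _ _ _).2 (Or.inr (Or.inr ⟨hp, ha⟩))
    obtain ⟨c, hc, hcq⟩ := hcon hq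
    have hqg : (q : M) ∈ g • h := by
      rw [← hcq]
      exact Set.smul_mem_smul_set hc
    have hbg : (b : M) ∉ g • h := fun hbg => hb (hg.1 hbg)
    have h1 := ((hh.smul g).m_mem_iff _ _ _).1 hqg
    tauto

/-! ### Essential and minimal actions -/

/-- Essential actions are minimal: a halfspace that is minimal among those containing a given
invariant set cannot be mapped strictly into itself. -/
theorem IsEssential.isMinimal [IsMedianAction G M] (hess : IsEssential G M) : IsMinimal G M := by
  intro C hne hinv hC
  by_contra hcon
  obtain ⟨x, hx⟩ := (Set.ne_univ_iff_exists_notMem C).1 hcon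
  obtain ⟨h, hh, hCh, hxh⟩ := exists_isHalfspace_separating hC (isConvex_singleton x) hne
    (Set.singleton_nonempty x) (Set.disjoint_singleton_right.2 hx)
  obtain ⟨k, hkh, hk⟩ := zorn_superset_nonempty {k | IsHalfspace k ∧ C ⊆ k} (by
    rintro c hc hcc ⟨h₀, hh₀⟩
    refine ⟨⋂₀ c, ⟨⟨hne.mono (Set.subset_sInter fun k hk => (hc hk).2),
      isConvex_sInter fun k hk => (hc hk).1.2.1,
      (hc hh₀).1.2.2.1.mono (Set.compl_subset_compl.2 (Set.sInter_subset_of_mem hh₀)), ?_⟩,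
      Set.subset_sInter fun k hk => (hc hk).2⟩, fun s hs => Set.sInter_subset_of_mem hs⟩
    exact isConvex_compl_sInter_of_isChain (fun k hk => (hc hk).1.2.2.2) hcc) h ⟨hh, hCh⟩
  obtain ⟨g, hg⟩ := hess k hk.prop.1
  have hCg : C ⊆ g • k := by
    rw [← hinv g]
    exact Set.smul_set_mono hk.prop.2
  exact hg.2 (hk.le_of_le ⟨hk.prop.1.smul g, hCg⟩ hg.1)

theorem InvariantConvexSubset.isEssential_of_forall_mem {C : InvariantConvexSubset G M}
    (hC : ∀ p, p ∈ C) (hess : IsEssential G C) : IsEssential G M := by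
  intro h hh
  have hk : IsHalfspace ((↑) ⁻¹' h : Set C) := by
    obtain ⟨⟨a, ha⟩, h1, ⟨b, hb⟩, h2⟩ := hh
    exact ⟨⟨⟨a, hC a⟩, ha⟩, fun x hx y hy z => h1 x hx y hy z, ⟨⟨b, hC b⟩, hb⟩,
      fun x hx y hy z => h2 x hx y hy z⟩
  obtain ⟨g, hg, hg'⟩ := hess _ hk
  refine ⟨g, ?_, fun hcon => hg' ?_⟩
  · rintro _ ⟨p, hp, rfl⟩
    exact hg (Set.smul_mem_smul_set (show (⟨p, hC p⟩ : C) ∈ ((↑) ⁻¹' h : Set C) from hp))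
  · intro c hc
    obtain ⟨p, hp, hpc⟩ := hcon hc
    exact ⟨⟨p, hC p⟩, hp, Subtype.ext hpc⟩

end Crossing

end MedianAlgebra

theorem theoremA {G M : Type*} [Group G] [Group.FG G] [MedianAlgebra M] [Nonempty M]
    [MulAction G M] [MedianAlgebra.IsMedianAction G M]
    (hrank : MedianAlgebra.rank M < ⊤)
    (hinv : MedianAlgebra.WithoutWallInversions G M) :
    (∃ C : MedianAlgebra.InvariantConvexSubset G M,
      (C : Set M).Nonempty ∧ MedianAlgebra.IsEssential G C) ∧
    (MedianAlgebra.IsEssential G M ↔ MedianAlgebra.IsMinimal G M) := by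
  obtain ⟨r, hr⟩ := MedianAlgebra.exists_rankLE hrank
  obtain ⟨y, hy⟩ := MedianAlgebra.exists_crossing_eq_empty (G := G) hr hinv
  have hess := MedianAlgebra.isEssential_orbitHull hy
  have hne : (MedianAlgebra.orbitHull G y : Set M).Nonempty :=
    ⟨y, MedianAlgebra.mem_orbitHull.2 fun h _ hgy => by simpa using hgy 1⟩
  refine ⟨⟨_, hne, hess⟩, fun h => h.isMinimal, fun hmin => ?_⟩
  have huniv := hmin (MedianAlgebra.orbitHull G y) hne (fun g => by
    ext p
    rw [Set.mem_smul_set_iff_inv_smul_mem]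
    refine ⟨fun hp => ?_, fun hp => (MedianAlgebra.orbitHull G y).smul_mem' g⁻¹ hp⟩
    have h1 := (MedianAlgebra.orbitHull G y).smul_mem' g hp
    rwa [smul_inv_smul] at h1) (MedianAlgebra.orbitHull G y).isConvex'
  exact MedianAlgebra.InvariantConvexSubset.isEssential_of_forall_mem
    (fun p => huniv.symm.subset (Set.mem_univ p)) hess
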